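/- For integers $k,d\ge 1$ let \[ \gamma_{k,d}=\lim_{n\to\infty}\frac{\mathbb{E}\left[\mathrm{LCS}(X^1,\dots,X^d)\right]}{n}, \] where $X^1,\dots,X^d$ are independent uniformly random strings in $\{1,\dots,k\}^n$ and $\mathrm{LCS}(X^1,\dots,X^d)$ is the length of a longest string that is a (not necessarily contiguous) subsequence of every $X^i$. There exist absolute constants $c_0,c_1,c_2>0$ such that, for all integers $k\ge 2$ and $d$ with $d\ge c_0\log_2 k$, the limit $\gamma_{k,d}$ exists and \[ \frac1k\left(1+\frac{c_1}{\sqrt d}\right)\ \le\ \gamma_{k,d}\ \le\ \frac1k\left(1+c_2\sqrt{\frac{\log_2 k}{d}}\right). \] -/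

import Mathlib

open Filter Topology

noncomputable section

/-- `commonSubseqLengths X` is the set of lengths of the strings that are a subsequence
(not necessarily contiguous) of every string `X i`. -/
def commonSubseqLengths {α ι : Type*} (X : ι → List α) : Set ℕ :=
  {m | ∃ w : List α, w.length = m ∧ ∀ i, List.Sublist w (X i)}

/-- The length of a longest common subsequence of the strings `X i`. For a nonempty family the set
is nonempty (it contains `0`) and bounded by the length of each `X i`, so this is a maximum. -/
def lcsLength {α ι : Type*} (X : ι → List α) : ℕ :=
  sSup (commonSubseqLengths X)

/-- The expected length of the longest common subsequence of `d` independent uniformly random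
strings of length `n` over an alphabet with `k` symbols. The tuple of strings is uniform on the
finite set of all `d`-tuples of strings, so the expectation is the average over that set. -/
def expectedLCS (k d n : ℕ) : ℝ :=
  (∑ X : Fin d → Fin n → Fin k, (lcsLength (fun i => List.ofFn (X i)) : ℝ)) /
    (Fintype.card (Fin d → Fin n → Fin k) : ℝ)

/-- The generalized Chvátal-Sankoff constant: the limit of `expectedLCS k d n / n` as `n → ∞`. -/
def chvatalSankoff (k d : ℕ) : ℝ :=
  limUnder atTop (fun n : ℕ => expectedLCS k d n / (n : ℝ))

end

/-! The limit exists by Fekete's lemma, since expected LCS length is superadditive under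
concatenation.

Upper bound: a first moment argument. The chance that a random string contains a given word obeys a
Chernoff bound depending only on the word's length (`card_superseq_mul_pow_le`). A union bound over
the `k ^ m` words of length `m ≈ (1 + ε) n / k` is exponentially small once `d ε² / 3` exceeds `(1 +
ε) log k` (`chvatalSankoff_le`).

Lower bound: an online strategy. Fix two letters and read each string up to its first occurrence of
either, at mean cost `k / 2`. Append the majority outcome to the common subsequence; strings in the
minority are read on to that letter, at mean cost `k` more. Fluctuations of order `√d` keep the
minority probability below `(1 - 1 / (2√d)) / 2` (`sum_ne_majority_le`), so a letter costs at most
`k (1 - 1 / (4√d))` per string on average.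

Concentration is built into `GeomBounded`: a union over strings of exponential Markov bounds, where
`β j` plays the role of the mean of `y⁻¹ ^ T` for `T` the number of letters read in string `j`. One
round multiplies a uniform coefficient by a fixed factor (`GeomBounded.majority_step`), and `y`
slightly below `1` recovers the mean cost (`exists_geometric_rate`). -/

/-! ### Averages over tuples of words of prescribed lengths -/

section Words

variable {α ι : Type*} [Fintype α]

/-- The words of length `n` over a finite alphabet. -/
def words (α : Type*) [Fintype α] (n : ℕ) : Finset (List α) :=
  Finset.univ.map ⟨fun x : Fin n → α => List.ofFn x, List.ofFn_injective⟩

theorem mem_words {n : ℕ} {w : List α} : w ∈ words α n ↔ w.length = n := by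
  constructor
  · intro h
    obtain ⟨x, -, rfl⟩ := Finset.mem_map.1 h
    simp
  · rintro rfl
    exact Finset.mem_map.2 ⟨w.get, Finset.mem_univ _, by simp⟩

theorem card_words (n : ℕ) : (words α n).card = Fintype.card α ^ n := by
  simp [words]

theorem words_zero : words α 0 = {[]} := by
  ext w
  simp [mem_words]

theorem sum_words_succ (n : ℕ) (f : List α → ℝ) :
    ∑ w ∈ words α (n + 1), f w = ∑ a, ∑ w ∈ words α n, f (a :: w) := by
  rw [← Finset.sum_product']
  symm
  refine Finset.sum_bij (fun p _ => p.1 :: p.2) ?_ ?_ ?_ ?_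
  · rintro ⟨a, w⟩ h
    simpa [mem_words] using h
  · rintro ⟨a, w⟩ _ ⟨b, v⟩ _ h
    simpa using h
  · intro w hw
    cases w with
    | nil => simp [mem_words] at hw
    | cons a w => exact ⟨(a, w), by simpa [mem_words] using hw, rfl⟩
  · intros
    rfl

variable [Fintype ι] [DecidableEq ι]

theorem sum_ofFn_eq_sum_words (n : ℕ) (g : (ι → List α) → ℝ) :
    ∑ X : ι → Fin n → α, g (fun i => List.ofFn (X i)) =
      ∑ X ∈ Fintype.piFinset (fun _ : ι => words α n), g X := by
  refine Finset.sum_bij (fun X _ i => List.ofFn (X i)) ?_ ?_ ?_ ?_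
  · intro X _
    simp [Fintype.mem_piFinset, mem_words]
  · intro X _ Y _ h
    funext i
    exact List.ofFn_injective (congrFun h i)
  · intro X hX
    have hX' : ∀ i, ∃ x : Fin n → α, List.ofFn x = X i := by
      intro i
      obtain ⟨x, -, hx⟩ := Finset.mem_map.1 (Fintype.mem_piFinset.1 hX i)
      exact ⟨x, hx⟩
    choose x hx using hX'
    exact ⟨x, Finset.mem_univ _, funext hx⟩
  · intros
    rfl

/-- The average of `F` over all tuples of words with lengths `ℓ`. -/
noncomputable def tupleAvg (ℓ : ι → ℕ) (F : (ι → List α) → ℝ) : ℝ :=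
  (∑ X ∈ Fintype.piFinset (fun i => words α (ℓ i)), F X) / (Fintype.card α : ℝ) ^ (∑ i, ℓ i)

theorem card_piFinset_words (ℓ : ι → ℕ) :
    (Fintype.piFinset (fun i => words α (ℓ i))).card = Fintype.card α ^ (∑ i, ℓ i) := by
  simp [Fintype.card_piFinset, card_words, Finset.prod_pow_eq_pow_sum]

theorem tupleAvg_mono (ℓ : ι → ℕ) {F G : (ι → List α) → ℝ} (h : ∀ X, F X ≤ G X) :
    tupleAvg ℓ F ≤ tupleAvg ℓ G := by
  unfold tupleAvg
  gcongr
  exact h _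

theorem tupleAvg_le_one [Nonempty α] (ℓ : ι → ℕ) {F : (ι → List α) → ℝ} (h : ∀ X, F X ≤ 1) :
    tupleAvg ℓ F ≤ 1 := by
  have hk : (0 : ℝ) < Fintype.card α := by exact_mod_cast Fintype.card_pos
  unfold tupleAvg
  rw [div_le_one (by positivity)]
  calc _ ≤ ∑ X ∈ Fintype.piFinset (fun i => words α (ℓ i)), (1 : ℝ) :=
        Finset.sum_le_sum fun X _ => h X
    _ = _ := by
        rw [Finset.sum_const, card_piFinset_words]
        simp

theorem expectedLCS_eq_tupleAvg (k d n : ℕ) :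
    expectedLCS k d n =
      tupleAvg (α := Fin k) (fun _ : Fin d => n) (fun X => (lcsLength X : ℝ)) := by
  unfold expectedLCS tupleAvg
  rw [sum_ofFn_eq_sum_words n (fun X : Fin d → List (Fin k) => (lcsLength X : ℝ))]
  congr 1
  simp [← pow_mul, mul_comm]

theorem sum_piFinset_words_update (ℓ : ι → ℕ) (i : ι) (n : ℕ) (F : (ι → List α) → ℝ) :
    ∑ X ∈ Fintype.piFinset (fun j => words α (Function.update ℓ i (n + 1) j)), F X =
      ∑ a, ∑ X ∈ Fintype.piFinset (fun j => words α (Function.update ℓ i n j)),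
        F (Function.update X i (a :: X i)) := by
  rw [← Finset.sum_product']
  symm
  refine Finset.sum_bij (fun p _ => Function.update p.2 i (p.1 :: p.2 i)) ?_ ?_ ?_ ?_
  · rintro ⟨a, X⟩ h
    simp only [Finset.mem_product, Finset.mem_univ, true_and, Fintype.mem_piFinset,
      mem_words] at h ⊢
    intro j
    have := h j
    by_cases hj : j = i
    · subst hj
      simpa using this
    · simpa [hj] using this
  · rintro ⟨a, X⟩ _ ⟨b, Y⟩ _ h
    have hi := congrFun h i
    simp only [Function.update_self, List.cons.injEq] at hi
    refine Prod.ext hi.1 (funext fun j => ?_)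
    by_cases hj : j = i
    · subst hj
      exact hi.2
    · simpa [hj] using congrFun h j
  · intro X hX
    simp only [Fintype.mem_piFinset, mem_words] at hX
    have hi := hX i
    rw [Function.update_self] at hi
    obtain ⟨a, w, haw⟩ := List.exists_cons_of_length_eq_add_one hi
    refine ⟨(a, Function.update X i w), ?_, ?_⟩
    · simp only [Finset.mem_product, Finset.mem_univ, true_and, Fintype.mem_piFinset, mem_words]
      intro j
      by_cases hj : j = i
      · subst hj
        rw [haw] at hi
        simpa using hi
      · simpa [hj] using hX j
    · simp [← haw]
  · intros
    rfl

theorem tupleAvg_update_succ (ℓ : ι → ℕ) (i : ι) (n : ℕ) (F : (ι → List α) → ℝ) :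
    tupleAvg (Function.update ℓ i (n + 1)) F =
      (∑ a, tupleAvg (Function.update ℓ i n) (fun X => F (Function.update X i (a :: X i)))) /
        Fintype.card α := by
  unfold tupleAvg
  rw [sum_piFinset_words_update, ← Finset.sum_div, div_div, ← pow_succ]
  congr 2
  rw [Finset.sum_update_of_mem (Finset.mem_univ i), Finset.sum_update_of_mem (Finset.mem_univ i)]
  ring

/-! ### Exponential Markov bounds for reading strings letter by letter -/

/-- The averages of `F` are at most a combination of geometric terms in the lengths. -/
def GeomBounded (y : ℝ) (F : (ι → List α) → ℝ) (β : ι → ℝ) : Prop :=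
  ∀ ℓ : ι → ℕ, tupleAvg ℓ F ≤ ∑ j, β j * y ^ ℓ j

theorem GeomBounded.mono {y : ℝ} (hy : 0 ≤ y) {F G : (ι → List α) → ℝ} {β β' : ι → ℝ}
    (h : GeomBounded y F β) (hF : ∀ X, G X ≤ F X) (hβ : ∀ j, β j ≤ β' j) :
    GeomBounded y G β' := fun ℓ =>
  (tupleAvg_mono ℓ hF).trans ((h ℓ).trans (Finset.sum_le_sum fun j _ =>
    mul_le_mul_of_nonneg_right (hβ j) (pow_nonneg hy _)))

/-- Read string `i` up to its first letter in the range of `e`. -/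
theorem GeomBounded.hit {κ : Type*} [Fintype κ] {e : κ → α} (he : Function.Injective e)
    {y : ℝ} (hy0 : 0 < y)
    {h : ℝ} (hh : h * (y * Fintype.card α - Fintype.card α + Fintype.card κ) = Fintype.card κ)
    (hκ : 0 < Fintype.card κ)
    {F : (ι → List α) → ℝ} (hF1 : ∀ X, F X ≤ 1) (i : ι)
    (hF : ∀ X a, F (Function.update X i (a :: X i)) ≤ F X) {β : κ → ι → ℝ}
    (hβ : ∀ c, GeomBounded y (fun X => F (Function.update X i (e c :: X i))) (β c))
    (hβ0 : ∀ c j, 0 ≤ β c j) {β' : ι → ℝ}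
    (hβ' : ∀ j, β' j = (if j = i then h else 1) * ((∑ c, β c j) / Fintype.card κ))
    (hβi : 1 ≤ β' i) : GeomBounded y F β' := by
  classical
  have hne : Nonempty α := by
    have : Nonempty κ := Fintype.card_pos_iff.1 hκ
    exact this.map e
  have hk : (0 : ℝ) < Fintype.card α := by exact_mod_cast Fintype.card_pos
  have hκ' : (0 : ℝ) < Fintype.card κ := by exact_mod_cast hκ
  have hle : Fintype.card κ ≤ Fintype.card α := Fintype.card_le_of_injective e he
  -- Only the length of string `i` varies in the induction; the other strings contribute the
  -- constant `R`.
  suffices key : ∀ (ℓ : ι → ℕ) (n : ℕ), tupleAvg (Function.update ℓ i n) F ≤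
      ∑ j ∈ Finset.univ.erase i, β' j * y ^ ℓ j + β' i * y ^ n by
    intro ℓ
    have := key ℓ (ℓ i)
    rwa [Function.update_eq_self, Finset.sum_erase_add _ _ (Finset.mem_univ i)] at this
  intro ℓ n
  have hβ'0 : ∀ j ≠ i, 0 ≤ β' j := by
    intro j hj
    rw [hβ' j, if_neg hj, one_mul]
    exact div_nonneg (Finset.sum_nonneg fun c _ => hβ0 c j) hκ'.le
  have hR : 0 ≤ ∑ j ∈ Finset.univ.erase i, β' j * y ^ ℓ j :=
    Finset.sum_nonneg fun j hj =>
      mul_nonneg (hβ'0 j (Finset.ne_of_mem_erase hj)) (pow_nonneg hy0.le _)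
  set R := ∑ j ∈ Finset.univ.erase i, β' j * y ^ ℓ j with hRdef
  induction n with
  -- An exhausted string may mean failure; `1 ≤ β' i` absorbs this.
  | zero =>
    have := tupleAvg_le_one (Function.update ℓ i 0) hF1
    simp only [pow_zero, mul_one]
    linarith
  | succ n ih =>
    rw [tupleAvg_update_succ, div_le_iff₀ hk]
    set S : Finset α := Finset.univ.image e
    have hS : S.card = Fintype.card κ := Finset.card_image_of_injective _ he
    rw [← Finset.sum_add_sum_compl S]
    have h1 : ∑ a ∈ S, tupleAvg (Function.update ℓ i n)
        (fun X => F (Function.update X i (a :: X i))) ≤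
          Fintype.card κ * R + (∑ c, β c i) * y ^ n := by
      rw [Finset.sum_image fun a _ b _ hab => he hab]
      refine (Finset.sum_le_sum fun c _ => hβ c (Function.update ℓ i n)).trans (le_of_eq ?_)
      rw [Finset.sum_comm, ← Finset.sum_erase_add _ _ (Finset.mem_univ i)]
      congr 1
      · rw [hRdef, Finset.mul_sum]
        refine Finset.sum_congr rfl fun j hj => ?_
        have hj' := Finset.ne_of_mem_erase hj
        rw [hβ' j, if_neg hj', one_mul, Function.update_of_ne hj', ← Finset.sum_mul]
        field_simp
      · rw [Function.update_self, Finset.sum_mul]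
    have h2 : ∑ a ∈ Sᶜ, tupleAvg (Function.update ℓ i n)
        (fun X => F (Function.update X i (a :: X i))) ≤
          (Fintype.card α - Fintype.card κ) * (R + β' i * y ^ n) := by
      refine (Finset.sum_le_sum fun a _ =>
        (tupleAvg_mono _ (fun X => hF X a)).trans ih).trans (le_of_eq ?_)
      rw [Finset.sum_const, Finset.card_compl, hS, nsmul_eq_mul, Nat.cast_sub hle]
    refine (add_le_add h1 h2).trans (le_of_eq ?_)
    have hβi' : β' i * Fintype.card κ = h * ∑ c, β c i := by
      rw [hβ' i, if_pos rfl]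
      field_simp
    -- The fixed point equation of the waiting time: `h` is the mean of `y⁻¹ ^ T` for `T` geometric
    -- with success probability `card κ / card α`.
    have hB : ∑ c, β c i = β' i * (y * Fintype.card α - Fintype.card α + Fintype.card κ) := by
      have h0 : h ≠ 0 := by
        rintro rfl
        rw [zero_mul] at hh
        exact hκ'.ne hh
      apply mul_left_cancel₀ h0
      rw [← hβi', mul_left_comm, hh]
    rw [hB, pow_succ]
    ring

/-- Resampling one coordinate preserves the uniform measure: exchanging `b i` with `c` is an
involution. -/
theorem sum_sum_update {κ : Type*} [Fintype κ] (i : ι) (φ : (ι → κ) → ℝ) :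
    ∑ b : ι → κ, ∑ c, φ (Function.update b i c) = Fintype.card κ * ∑ b, φ b := by
  have h : ∑ p : (ι → κ) × κ, φ (Function.update p.1 i p.2) = ∑ p : (ι → κ) × κ, φ p.1 := by
    refine Finset.sum_nbij' (fun p => (Function.update p.1 i p.2, p.1 i))
      (fun p => (Function.update p.1 i p.2, p.1 i)) ?_ ?_ ?_ ?_ ?_ <;> simp
  rw [← Fintype.sum_prod_type', h, Fintype.sum_prod_type, Finset.mul_sum]
  simp

/-- Read the strings in `s` up to their first letters in the range of `e`. -/
theorem GeomBounded.reveal {κ : Type*} [Fintype κ] {e : κ → α} (he : Function.Injective e)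
    {y : ℝ} (hy0 : 0 < y)
    {h : ℝ} (hh : h * (y * Fintype.card α - Fintype.card α + Fintype.card κ) = Fintype.card κ)
    (hκ : 0 < Fintype.card κ) (h1 : 1 ≤ h)
    {F : (ι → List α) → ℝ} (hF1 : ∀ X, F X ≤ 1)
    (hF : ∀ X Y : ι → List α, (∀ i, List.Sublist (X i) (Y i)) → F Y ≤ F X)
    {β : (ι → κ) → ι → ℝ}
    (hβ : ∀ b, GeomBounded y (fun X => F (fun j => e (b j) :: X j)) (β b))
    (hβ1 : ∀ b j, 1 ≤ β b j) (s : Finset ι) :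
    ∃ β' : (ι → κ) → ι → ℝ,
      (∀ b, GeomBounded y (fun X => F (fun j => if j ∈ s then X j else e (b j) :: X j)) (β' b)) ∧
      (∀ b j, 1 ≤ β' b j) ∧
      ∀ j, ∑ b, β' b j = (if j ∈ s then h else 1) * ∑ b, β b j := by
  have hκ' : (0 : ℝ) < Fintype.card κ := by exact_mod_cast hκ
  induction s using Finset.induction_on with
  | empty => exact ⟨β, by simpa using hβ, hβ1, by simp⟩
  | insert i s hi ih =>
    obtain ⟨γ, hγ, hγ1, hγs⟩ := ih
    have hge : ∀ b j, 1 ≤ (if j = i then h else 1) *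
        ((∑ c, γ (Function.update b i c) j) / Fintype.card κ) := by
      intro b j
      have : 1 ≤ (∑ c, γ (Function.update b i c) j) / Fintype.card κ := by
        rw [le_div_iff₀ hκ', one_mul]
        calc (Fintype.card κ : ℝ) = ∑ c : κ, (1 : ℝ) := by simp
          _ ≤ _ := Finset.sum_le_sum fun c _ => hγ1 _ _
      exact one_le_mul_of_one_le_of_one_le (by split_ifs <;> simp [h1]) this
    -- Once string `i` is unread, its first letter is averaged out; only its own coefficient pays
    -- the waiting factor `h`.
    refine ⟨fun b j => (if j = i then h else 1) *
      ((∑ c, γ (Function.update b i c) j) / Fintype.card κ), fun b => ?_, hge, fun j => ?_⟩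
    · refine GeomBounded.hit he hy0 hh hκ (fun X => hF1 _) i (fun X a => ?_)
        (β := fun c => γ (Function.update b i c)) (fun c => ?_)
        (fun c j => zero_le_one.trans (hγ1 _ _)) (fun j => rfl) (hge b i)
      · refine hF _ _ fun j => ?_
        by_cases hj : j = i
        · subst hj
          simp
        · simp [hj]
      · refine (hγ (Function.update b i c)).mono hy0.le (fun X => le_of_eq ?_) (fun j => le_rfl)
        congr 1
        funext j
        by_cases hj : j = i
        · subst hj
          simp [hi]
        · simp [hj]
    · rw [← Finset.mul_sum, ← Finset.sum_div, sum_sum_update i (fun b => γ b j), hγs j]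
      by_cases hj : j = i
      · subst hj
        simp only [hi, Finset.mem_insert_self, if_true, if_false]
        field_simp
      · simp only [hj, Finset.mem_insert, if_false, false_or]
        field_simp

end Words

/-! ### The bias of a random bit towards the majority -/

section Majority

/-- The sign `1` or `-1` of a Boolean. -/
noncomputable def boolSign (c : Bool) : ℝ := if c then 1 else -1

/-- The sum of the signs of a tuple of Booleans. -/
noncomputable def signSum {ι : Type*} [Fintype ι] (b : ι → Bool) : ℝ := ∑ j, boolSign (b j)

theorem sum_comp_signSum_succ (d : ℕ) (g : ℝ → ℝ) :
    ∑ b : Fin (d + 1) → Bool, g (signSum b) =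
      ∑ b : Fin d → Bool, (g (1 + signSum b) + g (-1 + signSum b)) := by
  rw [← (Fin.consEquiv (fun _ => Bool)).sum_comp, Fintype.sum_prod_type, Fintype.sum_bool,
    ← Finset.sum_add_distrib]
  simp [signSum, Fin.consEquiv, Fin.sum_univ_succ, boolSign]

theorem sum_signSum_sq (d : ℕ) : ∑ b : Fin d → Bool, signSum b ^ 2 = d * 2 ^ d := by
  induction d with
  | zero => simp [signSum]
  | succ d ih =>
    rw [sum_comp_signSum_succ d (· ^ 2)]
    calc _ = ∑ b : Fin d → Bool, (2 * signSum b ^ 2 + 2) :=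
          Finset.sum_congr rfl fun b _ => by ring
      _ = _ := by
        rw [Finset.sum_add_distrib, ← Finset.mul_sum, ih]
        simp
        ring

theorem sum_signSum_pow_four (d : ℕ) :
    ∑ b : Fin d → Bool, signSum b ^ 4 = (3 * d ^ 2 - 2 * d) * 2 ^ d := by
  induction d with
  | zero => simp [signSum]
  | succ d ih =>
    rw [sum_comp_signSum_succ d (· ^ 4)]
    calc _ = ∑ b : Fin d → Bool, (2 * signSum b ^ 4 + 12 * signSum b ^ 2 + 2) :=
          Finset.sum_congr rfl fun b _ => by ring
      _ = _ := by
        rw [Finset.sum_add_distrib, Finset.sum_add_distrib, ← Finset.mul_sum, ← Finset.mul_sum,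
          ih, sum_signSum_sq]
        simp
        ring

/-- Fourth moment method: a polynomial minorant of `|x|` in `x ^ 2` and `x ^ 4` reduces the bound to
the two moments above. -/
theorem le_sum_abs_signSum (d : ℕ) (hd : 0 < d) :
    √d / 2 * 2 ^ d ≤ ∑ b : Fin d → Bool, |signSum b| := by
  have hd' : (0 : ℝ) < d := by exact_mod_cast hd
  set r := √(d : ℝ)
  have hr : 0 < r := Real.sqrt_pos.2 hd'
  have hr2 : r ^ 2 = d := Real.sq_sqrt hd'.le
  have hpt : ∀ x : ℝ, x ^ 2 / r - x ^ 4 / (6 * r ^ 3) ≤ |x| := by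
    intro x
    obtain ⟨t, ht⟩ : ∃ t, |x| = t * r := ⟨|x| / r, by field_simp⟩
    have ht0 : 0 ≤ t := by
      by_contra! h
      have := mul_neg_of_neg_of_pos h hr
      have := abs_nonneg x
      linarith
    have h2 : x ^ 2 = t ^ 2 * r ^ 2 := by rw [← sq_abs, ht]; ring
    have h4 : x ^ 4 = t ^ 4 * r ^ 4 := by
      rw [show x ^ 4 = (x ^ 2) ^ 2 by ring, h2]; ring
    -- With weight `1 / 6`, the fourth moment, at most `3 d ^ 2`, cancels at most half of the main
    -- term.
    have key : t ^ 2 - t ^ 4 / 6 ≤ t := by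
      have : 0 ≤ t ^ 3 / 6 - t + 1 := by
        nlinarith [mul_nonneg (add_nonneg ht0 (by norm_num : (0 : ℝ) ≤ 3)) (sq_nonneg (t - 3 / 2)),
          sq_nonneg (t - 3 / 2), mul_nonneg ht0 (sq_nonneg (t - 3 / 2))]
      nlinarith [mul_nonneg ht0 this]
    calc x ^ 2 / r - x ^ 4 / (6 * r ^ 3) = (t ^ 2 - t ^ 4 / 6) * r := by
          rw [h2, h4]; field_simp
      _ ≤ t * r := by gcongr
      _ = |x| := ht.symm
  calc r / 2 * 2 ^ d ≤ (d * 2 ^ d) / r - ((3 * d ^ 2 - 2 * d) * 2 ^ d) / (6 * r ^ 3) := by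
        rw [← hr2]
        have : r ^ 2 * 2 ^ d / r - (3 * (r ^ 2) ^ 2 - 2 * r ^ 2) * 2 ^ d / (6 * r ^ 3) =
            r / 2 * 2 ^ d + 2 ^ d / (3 * r) := by
          field_simp
          ring
        rw [this]
        have : (0 : ℝ) ≤ 2 ^ d / (3 * r) := by positivity
        linarith
    _ = ∑ b : Fin d → Bool, (signSum b ^ 2 / r - signSum b ^ 4 / (6 * r ^ 3)) := by
        rw [Finset.sum_sub_distrib, ← Finset.sum_div, ← Finset.sum_div, sum_signSum_sq,
          sum_signSum_pow_four]
    _ ≤ _ := Finset.sum_le_sum fun b _ => hpt _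

/-- The majority value of a tuple of Booleans, with ties going to `true`. -/
noncomputable def majority {ι : Type*} [Fintype ι] (b : ι → Bool) : Bool := decide (0 ≤ signSum b)

theorem boolSign_majority_mul {ι : Type*} [Fintype ι] (b : ι → Bool) :
    boolSign (majority b) * signSum b = |signSum b| := by
  unfold majority boolSign
  by_cases h : 0 ≤ signSum b
  · simp [h, abs_of_nonneg]
  · simp [h, abs_of_neg (not_le.1 h)]

theorem sum_boolSign_majority_mul_eq {ι : Type*} [Fintype ι] [DecidableEq ι] (i j : ι) :
    ∑ b : ι → Bool, boolSign (majority b) * boolSign (b i) =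
      ∑ b : ι → Bool, boolSign (majority b) * boolSign (b j) := by
  rw [← (Equiv.arrowCongr (Equiv.swap i j) (Equiv.refl Bool)).sum_comp]
  refine Finset.sum_congr rfl fun b _ => ?_
  have : signSum ((Equiv.arrowCongr (Equiv.swap i j) (Equiv.refl Bool)) b) = signSum b := by
    unfold signSum
    rw [← Equiv.sum_comp (Equiv.swap i j)]
    simp
  simp [majority, this]

/-- All coordinates correlate equally with the majority, and the correlations add up to the mean of
`|signSum b|`, which is at least `√d / 2`. -/
theorem sum_ne_majority_le (d : ℕ) (j : Fin d) :
    ∑ b : Fin d → Bool, (if b j = majority b then (0 : ℝ) else 1) ≤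
      (1 - 1 / (2 * √d)) / 2 * 2 ^ d := by
  have hd : 0 < d := j.pos
  have hd' : (0 : ℝ) < d := by exact_mod_cast hd
  have h1 : ∀ b : Fin d → Bool, (if b j = majority b then (0 : ℝ) else 1) =
      (1 - boolSign (majority b) * boolSign (b j)) / 2 := by
    intro b
    cases b j <;> cases majority b <;> norm_num [boolSign]
  have h2 : d * ∑ b : Fin d → Bool, boolSign (majority b) * boolSign (b j) =
      ∑ b : Fin d → Bool, |signSum b| := by
    calc _ = ∑ i : Fin d, ∑ b : Fin d → Bool, boolSign (majority b) * boolSign (b i) := by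
          rw [Finset.sum_congr rfl fun i _ => sum_boolSign_majority_mul_eq i j]
          simp
      _ = _ := by
          rw [Finset.sum_comm]
          refine Finset.sum_congr rfl fun b _ => ?_
          rw [← Finset.mul_sum, ← boolSign_majority_mul]
          rfl
  have h3 := le_sum_abs_signSum d hd
  rw [← h2] at h3
  have h4 : 1 / (2 * √d) * 2 ^ d ≤
      ∑ b : Fin d → Bool, boolSign (majority b) * boolSign (b j) := by
    rw [← mul_le_mul_iff_right₀ hd']
    refine le_trans (le_of_eq ?_) h3
    have hr : 0 < √(d : ℝ) := Real.sqrt_pos.2 hd'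
    nth_rewrite 1 [← Real.sq_sqrt hd'.le]
    field_simp
  rw [Finset.sum_congr rfl fun b _ => h1 b, ← Finset.sum_div, Finset.sum_sub_distrib]
  simp only [Finset.sum_const, Finset.card_univ, Fintype.card_fun, Fintype.card_bool,
    Fintype.card_fin, nsmul_eq_mul, mul_one, Nat.cast_pow, Nat.cast_ofNat]
  linarith

end Majority

/-! ### Common subsequences and the failure indicator -/

section CommonSubsequences

variable {α ι : Type*}

theorem zero_mem_commonSubseqLengths (X : ι → List α) : 0 ∈ commonSubseqLengths X :=
  ⟨[], rfl, fun _ => List.nil_sublist _⟩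

theorem bddAbove_commonSubseqLengths [Nonempty ι] (X : ι → List α) :
    BddAbove (commonSubseqLengths X) := by
  obtain ⟨i⟩ := ‹Nonempty ι›
  refine ⟨(X i).length, ?_⟩
  rintro _ ⟨w, rfl, hw⟩
  exact (hw i).length_le

theorem lcsLength_mem [Nonempty ι] (X : ι → List α) :
    lcsLength X ∈ commonSubseqLengths X :=
  Nat.sSup_mem ⟨0, zero_mem_commonSubseqLengths X⟩ (bddAbove_commonSubseqLengths X)

theorem le_lcsLength_iff [Nonempty ι] (X : ι → List α) (m : ℕ) :
    m ≤ lcsLength X ↔ m ∈ commonSubseqLengths X := by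
  constructor
  · intro h
    obtain ⟨w, hw, hs⟩ := lcsLength_mem X
    exact ⟨w.take m, by simp [hw, h], fun i => (List.take_sublist m w).trans (hs i)⟩
  · exact fun h => le_csSup (bddAbove_commonSubseqLengths X) h

theorem lcsLength_le_length [Nonempty ι] (X : ι → List α) (i : ι) :
    lcsLength X ≤ (X i).length := by
  obtain ⟨w, hw, hs⟩ := lcsLength_mem X
  exact hw ▸ (hs i).length_le

open Classical in
/-- The indicator that the strings `X i` have no common subsequence of length `m`. -/
noncomputable def noCommonSubseq (m : ℕ) (X : ι → List α) : ℝ :=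
  if m ∈ commonSubseqLengths X then 0 else 1

theorem noCommonSubseq_le_one (m : ℕ) (X : ι → List α) : noCommonSubseq m X ≤ 1 := by
  unfold noCommonSubseq
  split_ifs <;> norm_num

theorem noCommonSubseq_le_of_imp {m n : ℕ} {X Y : ι → List α}
    (h : m ∈ commonSubseqLengths X → n ∈ commonSubseqLengths Y) :
    noCommonSubseq n Y ≤ noCommonSubseq m X := by
  unfold noCommonSubseq
  by_cases h1 : m ∈ commonSubseqLengths X
  · simp [h1, h h1]
  · split_ifs <;> norm_num

theorem noCommonSubseq_anti (m : ℕ) (X Y : ι → List α) (h : ∀ i, List.Sublist (X i) (Y i)) :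
    noCommonSubseq m Y ≤ noCommonSubseq m X :=
  noCommonSubseq_le_of_imp fun ⟨w, hw, hs⟩ => ⟨w, hw, fun i => (hs i).trans (h i)⟩

theorem noCommonSubseq_cons_le (m : ℕ) (X : ι → List α) (a : α) :
    noCommonSubseq (m + 1) (fun i => a :: X i) ≤ noCommonSubseq m X :=
  noCommonSubseq_le_of_imp fun ⟨w, hw, hs⟩ =>
    ⟨a :: w, by simp [hw], fun i => (hs i).cons_cons a⟩

end CommonSubsequences

/-! ### The majority strategy -/

section Strategy

variable {α : Type*} [Fintype α] {d : ℕ}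

/-- Append to the common subsequence the letter, out of two, that comes first in most strings. -/
theorem GeomBounded.majority_step {e : Bool → α} (he : Function.Injective e) {y : ℝ} (hy0 : 0 < y)
    {h₁ h₂ : ℝ} (h₁1 : 1 ≤ h₁) (h₂1 : 1 ≤ h₂)
    (hh₁ : h₁ * (y * Fintype.card α - Fintype.card α + 1) = 1)
    (hh₂ : h₂ * (y * Fintype.card α - Fintype.card α + 2) = 2) {m : ℕ} {R : ℝ} (hR : 1 ≤ R)
    (hm : GeomBounded y (noCommonSubseq m : (Fin d → List α) → ℝ) (fun _ => R)) :
    GeomBounded y (noCommonSubseq (m + 1) : (Fin d → List α) → ℝ)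
      (fun _ => R * (h₂ * (1 + (h₁ - 1) * ((1 - 1 / (2 * √d)) / 2)))) := by
  have hsecond : ∀ b : Fin d → Bool,
      GeomBounded y (fun X : Fin d → List α => noCommonSubseq (m + 1) fun j => e (b j) :: X j)
        (fun j => R * (1 + (h₁ - 1) * if b j = majority b then 0 else 1)) := by
    intro b
    obtain ⟨γ, hγ, -, hγs⟩ := GeomBounded.reveal (κ := Unit) (ι := Fin d)
      (e := fun _ => e (majority b))
      (fun _ _ _ => rfl) hy0 (h := h₁) (by simpa using hh₁) (by simp) h₁1
      (F := noCommonSubseq (m + 1)) (noCommonSubseq_le_one _) (noCommonSubseq_anti _)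
      (β := fun _ _ => R)
      (fun _ => hm.mono hy0.le (fun X => noCommonSubseq_cons_le m X _) fun _ => le_rfl)
      (fun _ _ => hR) (Finset.univ.filter fun j => b j ≠ majority b)
    refine (hγ default).mono hy0.le (fun X => ?_) (fun j => le_of_eq ?_)
    · refine noCommonSubseq_anti _ _ _ fun j => ?_
      by_cases hj : b j = majority b
      · simp [hj]
      · simp [hj]
    · have := hγs j
      simp only [Finset.univ_unique, Finset.sum_singleton] at this
      rw [this]
      by_cases hj : b j = majority b <;> simp [hj, mul_comm]
  -- Now the bits themselves are revealed: every string pays `h₂`, and averaging over `b` makes the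
  -- coefficients uniform again.
  obtain ⟨γ, hγ, -, hγs⟩ := GeomBounded.reveal (κ := Bool) (ι := Fin d) he hy0 (h := h₂)
      (by simpa using hh₂) (by simp) h₂1
      (F := noCommonSubseq (m + 1)) (noCommonSubseq_le_one _) (noCommonSubseq_anti _)
      hsecond (fun b j => by
        refine one_le_mul_of_one_le_of_one_le hR ?_
        split_ifs <;> linarith) Finset.univ
  intro ℓ
  have h2d : (0 : ℝ) < 2 ^ d := by positivity
  rw [← mul_le_mul_iff_right₀ h2d]
  calc _ = ∑ b : Fin d → Bool, tupleAvg ℓ (noCommonSubseq (m + 1) : (Fin d → List α) → ℝ) := by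
        simp
    _ ≤ ∑ b : Fin d → Bool, ∑ j, γ b j * y ^ ℓ j := by
        refine Finset.sum_le_sum fun b _ => ?_
        simpa using hγ b ℓ
    _ = ∑ j, (∑ b : Fin d → Bool, γ b j) * y ^ ℓ j := by
        rw [Finset.sum_comm]
        simp only [Finset.sum_mul]
    _ ≤ ∑ j, (2 ^ d * (R * (h₂ * (1 + (h₁ - 1) * ((1 - 1 / (2 * √d)) / 2))))) * y ^ ℓ j := by
        refine Finset.sum_le_sum fun j _ => mul_le_mul_of_nonneg_right ?_ (by positivity)
        rw [hγs j, if_pos (Finset.mem_univ j), ← Finset.mul_sum, Finset.sum_add_distrib,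
          ← Finset.mul_sum]
        have := sum_ne_majority_le d j
        have h3 : (h₁ - 1) * ∑ b : Fin d → Bool, (if b j = majority b then (0 : ℝ) else 1) ≤
          (h₁ - 1) * ((1 - 1 / (2 * √d)) / 2 * 2 ^ d) :=
          mul_le_mul_of_nonneg_left this (by linarith)
        have h4 : 0 ≤ h₂ * R := by nlinarith
        have h5 : ∑ b : Fin d → Bool, (1 : ℝ) = 2 ^ d := by simp
        rw [h5]
        nlinarith [mul_le_mul_of_nonneg_left h3 h4]
    _ = _ := by
        rw [Finset.mul_sum]
        exact Finset.sum_congr rfl fun j _ => by ring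

theorem geomBounded_noCommonSubseq {e : Bool → α} (he : Function.Injective e)
    {y : ℝ} (hy0 : 0 < y) {h₁ h₂ : ℝ} (h₁1 : 1 ≤ h₁) (h₂1 : 1 ≤ h₂)
    (hh₁ : h₁ * (y * Fintype.card α - Fintype.card α + 1) = 1)
    (hh₂ : h₂ * (y * Fintype.card α - Fintype.card α + 2) = 2) (hd : 0 < d) (m : ℕ) :
    GeomBounded y (noCommonSubseq m : (Fin d → List α) → ℝ)
      (fun _ => (h₂ * (1 + (h₁ - 1) * ((1 - 1 / (2 * √d)) / 2))) ^ m) := by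
  induction m with
  | zero =>
    intro ℓ
    have : (noCommonSubseq 0 : (Fin d → List α) → ℝ) = fun _ => 0 := by
      funext X
      simp [noCommonSubseq, zero_mem_commonSubseqLengths]
    rw [this]
    simp only [tupleAvg, Finset.sum_const_zero, zero_div]
    positivity
  | succ m ih =>
    rw [pow_succ]
    refine ih.majority_step he hy0 h₁1 h₂1 hh₁ hh₂ (one_le_pow₀ ?_)
    have hθ : 1 / (2 * √(d : ℝ)) ≤ 1 := by
      have : 1 ≤ √(d : ℝ) := Real.one_le_sqrt.2 (by exact_mod_cast hd)
      rw [div_le_one (by positivity)]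
      linarith
    refine one_le_mul_of_one_le_of_one_le h₂1 ?_
    have := mul_nonneg (sub_nonneg.2 h₁1) (sub_nonneg.2 hθ)
    linarith

end Strategy

/-! ### Superadditivity and existence of the limit -/

section Limit

theorem lcsLength_append_ge {α ι : Type*} [Nonempty ι] (X Y : ι → List α) :
    lcsLength X + lcsLength Y ≤ lcsLength fun i => X i ++ Y i := by
  rw [le_lcsLength_iff]
  obtain ⟨v, hv, hvs⟩ := lcsLength_mem X
  obtain ⟨w, hw, hws⟩ := lcsLength_mem Y
  exact ⟨v ++ w, by simp [hv, hw], fun i => (hvs i).append (hws i)⟩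

theorem expectedLCS_add_ge {k d : ℕ} (hk : 0 < k) (hd : 0 < d) (m n : ℕ) :
    expectedLCS k d m + expectedLCS k d n ≤ expectedLCS k d (m + n) := by
  have : Nonempty (Fin d) := ⟨⟨0, hd⟩⟩
  have hk' : (0 : ℝ) < k := by exact_mod_cast hk
  let A := Fin d → Fin m → Fin k
  let B := Fin d → Fin n → Fin k
  let E : A × B ≃ (Fin d → Fin (m + n) → Fin k) :=
    (Equiv.arrowProdEquivProdArrow (Fin d) (fun _ => Fin m → Fin k)
      (fun _ => Fin n → Fin k)).symm.trans
      (Equiv.arrowCongr (Equiv.refl _) (Fin.appendEquiv m n))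
  have hA : (0 : ℝ) < Fintype.card A := by simp [A]; positivity
  have hB : (0 : ℝ) < Fintype.card B := by simp [B]; positivity
  have hcard : (Fintype.card (Fin d → Fin (m + n) → Fin k) : ℝ) =
      Fintype.card A * Fintype.card B := by
    rw [← Fintype.card_congr E, Fintype.card_prod, Nat.cast_mul]
  unfold expectedLCS
  rw [hcard, ← E.sum_comp, Fintype.sum_prod_type, le_div_iff₀ (by positivity)]
  have h1 : ∀ (x : A) (y : B),
      (lcsLength (fun i => List.ofFn (x i)) : ℝ) + lcsLength (fun i => List.ofFn (y i)) ≤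
        lcsLength fun i => List.ofFn (E (x, y) i) := by
    intro x y
    have := lcsLength_append_ge (fun i => List.ofFn (x i)) (fun i => List.ofFn (y i))
    have h2 : (fun i => List.ofFn (E (x, y) i)) =
        fun i => List.ofFn (x i) ++ List.ofFn (y i) := by
      funext i
      exact List.ofFn_fin_append _ _
    rw [h2]
    exact_mod_cast this
  refine le_trans (le_of_eq ?_)
    (Finset.sum_le_sum fun x _ => Finset.sum_le_sum fun y _ => h1 x y)
  simp only [Finset.sum_add_distrib, Finset.sum_const, Finset.card_univ, nsmul_eq_mul]
  rw [← Finset.mul_sum]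
  change (_ / (Fintype.card A : ℝ) + _ / (Fintype.card B : ℝ)) * _ = _
  field_simp
  ring

theorem expectedLCS_le {k d : ℕ} (hk : 0 < k) (hd : 0 < d) (n : ℕ) :
    expectedLCS k d n ≤ n := by
  have : Nonempty (Fin d) := ⟨⟨0, hd⟩⟩
  have : Nonempty (Fin k) := ⟨⟨0, hk⟩⟩
  unfold expectedLCS
  rw [div_le_iff₀ (by exact_mod_cast Fintype.card_pos)]
  calc _ ≤ ∑ X : Fin d → Fin n → Fin k, (n : ℝ) := by
        refine Finset.sum_le_sum fun X _ => ?_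
        have := lcsLength_le_length (fun i => List.ofFn (X i)) ⟨0, hd⟩
        simp only [List.length_ofFn] at this
        exact_mod_cast this
    _ = _ := by
        rw [Finset.sum_const, Finset.card_univ, nsmul_eq_mul, mul_comm]

theorem tendsto_expectedLCS_div {k d : ℕ} (hk : 0 < k) (hd : 0 < d) :
    Tendsto (fun n : ℕ => expectedLCS k d n / (n : ℝ)) atTop (𝓝 (chvatalSankoff k d)) := by
  have hsub : Subadditive fun n => -expectedLCS k d n := by
    intro m n
    have := expectedLCS_add_ge hk hd m n
    linarith
  have hbdd : BddBelow (Set.range fun n : ℕ => -expectedLCS k d n / n) := by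
    refine ⟨-1, ?_⟩
    rintro _ ⟨n, rfl⟩
    have := expectedLCS_le hk hd n
    simp only [neg_div, neg_le_neg_iff]
    exact div_le_one_of_le₀ this (Nat.cast_nonneg n)
  have h := (hsub.tendsto_lim hbdd).neg
  simp only [neg_div, neg_neg] at h
  unfold chvatalSankoff
  rwa [h.limUnder_eq]

end Limit

/-! ### The first moment upper bound -/

section UpperBound

theorem tupleAvg_mono_of_length {α ι : Type*} [Fintype α] [Fintype ι] [DecidableEq ι]
    (ℓ : ι → ℕ) {F G : (ι → List α) → ℝ}
    (h : ∀ X : ι → List α, (∀ i, (X i).length = ℓ i) → F X ≤ G X) :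
    tupleAvg ℓ F ≤ tupleAvg ℓ G := by
  unfold tupleAvg
  gcongr with X hX
  exact h X fun i => mem_words.1 (Fintype.mem_piFinset.1 hX i)

/-- Greedy matching: exactly one value of the next letter advances in `w`, gaining a factor `t`, and
the other `card α - 1` leave `w` unchanged. -/
theorem card_superseq_mul_pow_le {α : Type*} [Fintype α] [DecidableEq α] [Nonempty α] {t : ℝ}
    (ht : 1 ≤ t) (n : ℕ) (w : List α) :
    (∑ x ∈ words α n, if List.Sublist w x then (1 : ℝ) else 0) * t ^ w.length ≤
      (Fintype.card α - 1 + t) ^ n := by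
  have hk : (1 : ℝ) ≤ Fintype.card α := by exact_mod_cast Fintype.card_pos (α := α)
  induction n generalizing w with
  | zero =>
    rw [words_zero, Finset.sum_singleton]
    cases w <;> simp
  | succ n ih =>
    cases w with
    | nil =>
      simp only [List.nil_sublist, if_true, Finset.sum_const, card_words, nsmul_eq_mul, mul_one,
        List.length_nil, pow_zero, Nat.cast_pow]
      gcongr
      linarith
    | cons b w =>
      have h1 := ih w
      have h2 := ih (b :: w)
      rw [sum_words_succ, ← Finset.add_sum_erase _ _ (Finset.mem_univ b)]
      have h3 : ∀ a ∈ Finset.univ.erase b,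
          (∑ x ∈ words α n, if List.Sublist (b :: w) (a :: x) then (1 : ℝ) else 0) =
            ∑ x ∈ words α n, if List.Sublist (b :: w) x then (1 : ℝ) else 0 := by
        intro a ha
        have hne : b ≠ a := (Finset.ne_of_mem_erase ha).symm
        simp [List.cons_sublist_cons', hne]
      rw [Finset.sum_congr rfl h3, Finset.sum_const, Finset.card_erase_of_mem (Finset.mem_univ b),
        Finset.card_univ, nsmul_eq_mul, Nat.cast_sub Fintype.card_pos, Nat.cast_one]
      simp only [List.cons_sublist_cons]
      simp only [List.length_cons] at h2 ⊢
      calc _ = t * ((∑ x ∈ words α n, if List.Sublist w x then (1 : ℝ) else 0) * t ^ w.length) +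
            (Fintype.card α - 1) * ((∑ x ∈ words α n,
              if List.Sublist (b :: w) x then (1 : ℝ) else 0) * t ^ (w.length + 1)) := by ring
        _ ≤ t * (Fintype.card α - 1 + t) ^ n +
            (Fintype.card α - 1) * (Fintype.card α - 1 + t) ^ n :=
          add_le_add (mul_le_mul_of_nonneg_left h1 (by linarith))
            (mul_le_mul_of_nonneg_left h2 (by linarith))
        _ = _ := by ring

/-- The LCS is at most `m`, plus `n` times the number of words of length `m` common to all strings;
independence gives the `d`-th power. -/
theorem expectedLCS_le_add {k d : ℕ} (hk : 0 < k) (hd : 0 < d) {t : ℝ} (ht : 1 ≤ t) (m n : ℕ) :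
    expectedLCS k d n ≤ m + n * (k ^ m * ((1 + (t - 1) / k) ^ n / t ^ m) ^ d) := by
  have : Nonempty (Fin d) := ⟨⟨0, hd⟩⟩
  have : Nonempty (Fin k) := ⟨⟨0, hk⟩⟩
  have hk' : (0 : ℝ) < k := by exact_mod_cast hk
  have hpt : ∀ X : Fin d → List (Fin k), (∀ i, (X i).length = n) →
      (lcsLength X : ℝ) ≤ m + n * ∑ w ∈ words (Fin k) m,
        ∏ i, (if List.Sublist w (X i) then (1 : ℝ) else 0) := by
    intro X hX
    have hnn : ∀ w ∈ words (Fin k) m,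
        (0 : ℝ) ≤ ∏ i, (if List.Sublist w (X i) then (1 : ℝ) else 0) := fun w _ =>
      Finset.prod_nonneg fun i _ => by split_ifs <;> norm_num
    by_cases hm : m ≤ lcsLength X
    · obtain ⟨w, hw, hs⟩ := (le_lcsLength_iff X m).1 hm
      have h1 : (1 : ℝ) ≤ ∑ w ∈ words (Fin k) m,
          ∏ i, (if List.Sublist w (X i) then (1 : ℝ) else 0) := by
        refine le_trans (le_of_eq ?_) (Finset.single_le_sum hnn (mem_words.2 hw))
        simp [hs]
      have h2 : (lcsLength X : ℝ) ≤ n := by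
        have := lcsLength_le_length X ⟨0, hd⟩
        rw [hX] at this
        exact_mod_cast this
      have h3 : (n : ℝ) * 1 ≤ n * _ := mul_le_mul_of_nonneg_left h1 (Nat.cast_nonneg n)
      have : (0 : ℝ) ≤ m := Nat.cast_nonneg m
      linarith
    · have h1 : (lcsLength X : ℝ) ≤ m := by exact_mod_cast (not_le.1 hm).le
      have h2 := mul_nonneg (Nat.cast_nonneg (α := ℝ) n) (Finset.sum_nonneg hnn)
      linarith
  rw [expectedLCS_eq_tupleAvg]
  refine (tupleAvg_mono_of_length _ hpt).trans ?_
  have hcard : ((Fintype.piFinset fun _ : Fin d => words (Fin k) n).card : ℝ) = (k ^ n) ^ d := by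
    rw [card_piFinset_words]
    simp [← pow_mul, mul_comm]
  unfold tupleAvg
  rw [Finset.sum_add_distrib, Finset.sum_const, nsmul_eq_mul, hcard, ← Finset.mul_sum,
    Finset.sum_comm]
  have hcount : ∀ w ∈ words (Fin k) m,
      ∑ X ∈ Fintype.piFinset fun _ : Fin d => words (Fin k) n,
        ∏ i, (if List.Sublist w (X i) then (1 : ℝ) else 0) ≤ ((k - 1 + t) ^ n / t ^ m) ^ d := by
    intro w hw
    rw [Finset.sum_prod_piFinset (words (Fin k) n)
      (fun (_ : Fin d) x => if List.Sublist w x then (1 : ℝ) else 0)]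
    rw [Finset.prod_const, Finset.card_univ, Fintype.card_fin]
    refine pow_le_pow_left₀ (Finset.sum_nonneg fun x _ => by split_ifs <;> norm_num) ?_ d
    rw [le_div_iff₀ (by positivity)]
    have := card_superseq_mul_pow_le ht n w
    rwa [mem_words.1 hw, Fintype.card_fin] at this
  have hsum : ∑ w ∈ words (Fin k) m,
      ∑ X ∈ Fintype.piFinset fun _ : Fin d => words (Fin k) n,
        ∏ i, (if List.Sublist w (X i) then (1 : ℝ) else 0) ≤
          k ^ m * ((k - 1 + t) ^ n / t ^ m) ^ d := by
    refine (Finset.sum_le_sum hcount).trans (le_of_eq ?_)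
    rw [Finset.sum_const, card_words, nsmul_eq_mul, Fintype.card_fin, Nat.cast_pow]
  have hpow : (Fintype.card (Fin k) : ℝ) ^ (∑ _i : Fin d, n) = (k ^ n) ^ d := by
    simp [← pow_mul, mul_comm]
  have hfac : (1 + (t - 1) / k) ^ n = (k - 1 + t) ^ n / (k : ℝ) ^ n := by
    rw [← div_pow]
    congr 1
    field_simp
    ring
  rw [hpow, div_le_iff₀ (by positivity), hfac]
  calc _ ≤ (k ^ n) ^ d * (m : ℝ) + n * (k ^ m * ((k - 1 + t) ^ n / t ^ m) ^ d) := by gcongr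
    _ = _ := by
        simp only [div_pow]
        field_simp

theorem chvatalSankoff_le {k d : ℕ} (hk : 0 < k) (hd : 0 < d) {ε : ℝ} (hε0 : 0 < ε)
    (hε1 : ε ≤ 1) (hε : 2 * Real.log k < d * (ε ^ 2 / 3)) :
    chvatalSankoff k d ≤ 1 / k * (1 + ε) := by
  have hk' : (0 : ℝ) < k := by exact_mod_cast hk
  have hk1 : (1 : ℝ) ≤ k := by exact_mod_cast hk
  have hlogk : 0 ≤ Real.log k := Real.log_nonneg hk1
  set a : ℝ := 1 / k * (1 + ε) with ha
  have ha0 : 0 ≤ a := by positivity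
  set δ : ℝ := (d * (ε ^ 2 / 3) - (1 + ε) * Real.log k) / k
  -- Since `ε ≤ 1`, the union bound costs `(1 + ε) log k ≤ 2 log k`.
  have hδ : 0 < δ := by
    apply div_pos _ hk'
    nlinarith
  have hlog : ε + ε ^ 2 / 3 ≤ (1 + ε) * Real.log (1 + ε) := by
    have h1 := Real.le_log_one_add_of_nonneg hε0.le
    have h2 : ε + ε ^ 2 / 3 ≤ (1 + ε) * (2 * ε / (ε + 2)) := by
      rw [← mul_div_assoc, le_div_iff₀ (by linarith)]
      nlinarith [mul_nonneg (sq_nonneg ε) (sub_nonneg.2 hε1)]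
    exact h2.trans (mul_le_mul_of_nonneg_left h1 (by linarith))
  have hbound : ∀ n : ℕ, 0 < n → expectedLCS k d n / n ≤
      (⌈a * n⌉₊ : ℝ) / n + k * Real.exp (-δ) ^ n := by
    intro n hn
    have hn' : (0 : ℝ) < n := by exact_mod_cast hn
    set m := ⌈a * n⌉₊
    have hm1 : a * n ≤ m := Nat.le_ceil _
    have hm2 : (m : ℝ) < a * n + 1 := Nat.ceil_lt_add_one (by positivity)
    have hE := expectedLCS_le_add hk hd (t := 1 + ε) (by linarith) m n
    have hmain : (k : ℝ) ^ m * ((1 + (1 + ε - 1) / k) ^ n / (1 + ε) ^ m) ^ d ≤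
        k * Real.exp (-δ) ^ n := by
      have e1 : (k : ℝ) ^ m ≤ k * Real.exp (a * n * Real.log k) := by
        rw [← Real.rpow_natCast, Real.rpow_def_of_pos hk']
        calc Real.exp (Real.log k * m) ≤ Real.exp (Real.log k + a * n * Real.log k) := by
              apply Real.exp_le_exp.2
              nlinarith
          _ = _ := by rw [Real.exp_add, Real.exp_log hk']
      have e2 : (1 + (1 + ε - 1) / (k : ℝ)) ^ n ≤ Real.exp (n * (ε / k)) := by
        rw [Real.exp_nat_mul]
        refine pow_le_pow_left₀ (by rw [add_sub_cancel_left]; positivity) ?_ n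
        have := Real.add_one_le_exp (ε / k)
        rw [add_sub_cancel_left]
        linarith
      have e3 : Real.exp (a * n * Real.log (1 + ε)) ≤ (1 + ε) ^ m := by
        rw [← Real.rpow_natCast, Real.rpow_def_of_pos (by linarith), mul_comm]
        apply Real.exp_le_exp.2
        exact mul_le_mul_of_nonneg_left hm1 (Real.log_nonneg (by linarith))
      have e4 : (1 + (1 + ε - 1) / (k : ℝ)) ^ n / (1 + ε) ^ m ≤
          Real.exp (-(n / k * (ε ^ 2 / 3))) := by
        calc _ ≤ Real.exp (n * (ε / k)) / Real.exp (a * n * Real.log (1 + ε)) := by gcongr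
          _ = Real.exp (n * (ε / k) - a * n * Real.log (1 + ε)) := (Real.exp_sub _ _).symm
          _ ≤ _ := by
            apply Real.exp_le_exp.2
            have : n * (ε / k) - a * n * Real.log (1 + ε) =
                n / k * (ε - (1 + ε) * Real.log (1 + ε)) := by
              rw [ha]
              field_simp
            rw [this, ← mul_neg]
            exact mul_le_mul_of_nonneg_left (by linarith) (by positivity)
      have e5 : 0 ≤ (1 + (1 + ε - 1) / (k : ℝ)) ^ n / (1 + ε) ^ m := by
        rw [add_sub_cancel_left]
        positivity
      calc _ ≤ k * Real.exp (a * n * Real.log k) *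
            Real.exp (-(n / k * (ε ^ 2 / 3))) ^ d :=
            mul_le_mul e1 (pow_le_pow_left₀ e5 e4 d) (pow_nonneg e5 d) (by positivity)
        _ = k * Real.exp (-δ) ^ n := by
            rw [← Real.exp_nat_mul, ← Real.exp_nat_mul, mul_assoc, ← Real.exp_add]
            congr 2
            simp only [ha, δ]
            field_simp
            ring
    rw [div_le_iff₀ hn', add_mul, div_mul_cancel₀ _ hn'.ne', mul_comm _ (n : ℝ)]
    refine hE.trans ?_
    gcongr
  have hlim : Tendsto (fun n : ℕ => (⌈a * n⌉₊ : ℝ) / n + k * Real.exp (-δ) ^ n) atTop (𝓝 a) := by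
    have h1 := (tendsto_nat_ceil_mul_div_atTop ha0).comp (tendsto_natCast_atTop_atTop (R := ℝ))
    have h2 := (tendsto_pow_atTop_nhds_zero_of_lt_one (Real.exp_pos (-δ)).le
      (Real.exp_zero ▸ Real.exp_lt_exp.2 (by linarith : -δ < 0))).const_mul (k : ℝ)
    simpa using h1.add h2
  exact le_of_tendsto_of_tendsto (tendsto_expectedLCS_div hk hd) hlim
    ((eventually_gt_atTop 0).mono hbound)

end UpperBound

/-! ### From the strategy to the lower bound -/

section LowerBound

theorem mul_one_sub_le_expectedLCS {k d : ℕ} (hk : 2 ≤ k) (hd : 0 < d) {y : ℝ} (hy0 : 0 < y)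
    {h₁ h₂ : ℝ} (h₁1 : 1 ≤ h₁) (h₂1 : 1 ≤ h₂) (hh₁ : h₁ * (y * k - k + 1) = 1)
    (hh₂ : h₂ * (y * k - k + 2) = 2) (m n : ℕ) :
    m * (1 - d * ((h₂ * (1 + (h₁ - 1) * ((1 - 1 / (2 * √d)) / 2))) ^ m * y ^ n)) ≤
      expectedLCS k d n := by
  have : Nonempty (Fin d) := ⟨⟨0, hd⟩⟩
  have : Nonempty (Fin k) := ⟨⟨0, by omega⟩⟩
  let e : Bool → Fin k := fun c => if c then ⟨1, by omega⟩ else ⟨0, by omega⟩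
  have he : Function.Injective e := by
    intro a b
    cases a <;> cases b <;> simp [e]
  have hG := geomBounded_noCommonSubseq (d := d) he hy0 h₁1 h₂1 (by simpa using hh₁)
    (by simpa using hh₂) hd m (fun _ => n)
  simp only [Finset.sum_const, Finset.card_univ, Fintype.card_fin, nsmul_eq_mul] at hG
  rw [expectedLCS_eq_tupleAvg]
  have hpt : ∀ X : Fin d → List (Fin k), (m : ℝ) - m * noCommonSubseq m X ≤ lcsLength X := by
    intro X
    unfold noCommonSubseq
    split_ifs with h
    · have := (le_lcsLength_iff X m).2 h
      simpa using this
    · simp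
  refine le_trans ?_ (tupleAvg_mono _ hpt)
  have hk0 : (0 : ℝ) < k := by exact_mod_cast (by omega : 0 < k)
  have : tupleAvg (fun _ : Fin d => n) (fun X : Fin d → List (Fin k) =>
      (m : ℝ) - m * noCommonSubseq m X) =
        m - m * tupleAvg (fun _ : Fin d => n) (noCommonSubseq m : (Fin d → List (Fin k)) → ℝ) := by
    unfold tupleAvg
    rw [Finset.sum_sub_distrib, Finset.sum_const, nsmul_eq_mul, card_piFinset_words,
      ← Finset.mul_sum]
    simp only [Nat.cast_pow, Fintype.card_fin]
    field_simp
  rw [this, mul_sub, mul_one]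
  have := mul_le_mul_of_nonneg_left hG (Nat.cast_nonneg (α := ℝ) m)
  linarith

/-- At `y = 1` the exponent vanishes with derivative `1 - a * (k * (1 / 2 + c))`, positive by
hypothesis, so it is negative just left of `1`. -/
theorem exists_geometric_rate {k : ℝ} (hk : 0 < k) {c a : ℝ}
    (ha : a * (k * (1 / 2 + c)) < 1) :
    ∃ y h₁ h₂ : ℝ, 0 < y ∧ 1 ≤ h₁ ∧ 1 ≤ h₂ ∧ h₁ * (y * k - k + 1) = 1 ∧
      h₂ * (y * k - k + 2) = 2 ∧
      a * Real.log (h₂ * (1 + (h₁ - 1) * c)) + Real.log y < 0 := by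
  let f₁ : ℝ → ℝ := fun y => 1 / (y * k - k + 1)
  let f₂ : ℝ → ℝ := fun y => 2 / (y * k - k + 2)
  let f : ℝ → ℝ := fun y => a * Real.log (f₂ y * (1 + (f₁ y - 1) * c)) + Real.log y
  have hlin : ∀ r : ℝ, HasDerivAt (fun y : ℝ => y * k - k + r) k 1 := fun r => by
    simpa using (((hasDerivAt_id (1 : ℝ)).mul_const k).sub_const k).add_const r
  have hf₁ : HasDerivAt f₁ (-k) 1 := by
    have : HasDerivAt f₁ _ 1 :=
      (hasDerivAt_const (1 : ℝ) (1 : ℝ)).div (hlin 1) (by norm_num)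
    exact this.congr_deriv (by norm_num)
  have hf₂ : HasDerivAt f₂ (-k / 2) 1 := by
    have : HasDerivAt f₂ _ 1 :=
      (hasDerivAt_const (1 : ℝ) (2 : ℝ)).div (hlin 2) (by norm_num)
    refine this.congr_deriv ?_
    norm_num
    ring
  have hf₁1 : f₁ 1 = 1 := by simp [f₁]
  have hf₂1 : f₂ 1 = 1 := by simp [f₂]
  have hf1 : f 1 = 0 := by simp [f, hf₁1, hf₂1]
  have hf : HasDerivAt f (1 - a * (k * (1 / 2 + c))) 1 := by
    have h1 := hf₂.mul (((hf₁.sub_const 1).mul_const c).const_add 1)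
    have h2 : HasDerivAt f _ 1 := ((h1.log (by simp [hf₁1, hf₂1])).const_mul a).add
      (Real.hasDerivAt_log one_ne_zero)
    refine h2.congr_deriv ?_
    simp [hf₁1, hf₂1]
    ring
  have hsign := eventually_nhdsWithin_sign_eq_of_deriv_pos
    (by rw [hf.deriv]; linarith : deriv f 1 > 0) hf1
  have hev : ∀ᶠ y in 𝓝 (1 : ℝ), 0 < y ∧ 0 < y * k - k + 1 := by
    refine (lt_mem_nhds one_pos).and ?_
    have := (hlin 1).continuousAt
    exact this.eventually (lt_mem_nhds (by norm_num))
  obtain ⟨y, hy1, hs, hy0, hy2⟩ :=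
    (eventually_mem_nhdsWithin.and ((hsign.and hev).filter_mono
      (nhdsWithin_le_nhds (s := Set.Iio (1 : ℝ))))).exists
  have hy1 : y < 1 := hy1
  have hyk : y * k ≤ k := by nlinarith
  refine ⟨y, f₁ y, f₂ y, hy0, ?_, ?_, ?_, ?_, ?_⟩
  · rw [one_le_div hy2]
    linarith
  · rw [one_le_div (by linarith)]
    linarith
  · exact div_mul_cancel₀ _ hy2.ne'
  · exact div_mul_cancel₀ _ (by linarith : (0 : ℝ) < y * k - k + 2).ne'
  · have : SignType.sign (f y) = -1 := by
      rw [hs]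
      exact sign_neg (by linarith)
    exact sign_eq_neg_one_iff.1 this

/-- With `m = ⌊a * n⌋₊` rounds, the failure probability is at most `d * exp δ ^ n` with `δ < 0`. -/
theorem le_chvatalSankoff_of_lt {k d : ℕ} (hk : 2 ≤ k) (hd : 0 < d) {a : ℝ} (ha0 : 0 ≤ a)
    (ha : a * (k * (1 / 2 + (1 - 1 / (2 * √d)) / 2)) < 1) : a ≤ chvatalSankoff k d := by
  have hk0 : (0 : ℝ) < k := by exact_mod_cast (by omega : 0 < k)
  have hθ : 1 / (2 * √(d : ℝ)) ≤ 1 := by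
    have : 1 ≤ √(d : ℝ) := Real.one_le_sqrt.2 (by exact_mod_cast hd)
    rw [div_le_one (by positivity)]
    linarith
  obtain ⟨y, h₁, h₂, hy0, h₁1, h₂1, hh₁, hh₂, hneg⟩ :=
    exists_geometric_rate hk0 (c := (1 - 1 / (2 * √d)) / 2) ha
  set ρ := h₂ * (1 + (h₁ - 1) * ((1 - 1 / (2 * √d)) / 2)) with hρ
  have hρ1 : 1 ≤ ρ := by
    refine one_le_mul_of_one_le_of_one_le h₂1 ?_
    have := mul_nonneg (sub_nonneg.2 h₁1) (sub_nonneg.2 hθ)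
    linarith
  set δ := a * Real.log ρ + Real.log y
  have hbound : ∀ n : ℕ, 0 < n →
      (⌊a * n⌋₊ : ℝ) / n * (1 - d * Real.exp δ ^ n) ≤ expectedLCS k d n / n := by
    intro n hn
    have hn' : (0 : ℝ) < n := by exact_mod_cast hn
    have hE := mul_one_sub_le_expectedLCS hk hd hy0 h₁1 h₂1 hh₁ hh₂ ⌊a * n⌋₊ n
    have hfl : (⌊a * n⌋₊ : ℝ) ≤ a * n := Nat.floor_le (by positivity)
    have hpow : ρ ^ ⌊a * n⌋₊ * y ^ n ≤ Real.exp δ ^ n := by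
      rw [← Real.exp_nat_mul, ← Real.rpow_natCast, Real.rpow_def_of_pos (by linarith),
        ← Real.rpow_natCast, Real.rpow_def_of_pos hy0, ← Real.exp_add]
      apply Real.exp_le_exp.2
      have := mul_le_mul_of_nonneg_left hfl (Real.log_nonneg hρ1)
      simp only [δ]
      linarith
    rw [div_mul_eq_mul_div]
    refine div_le_div_of_nonneg_right (le_trans ?_ hE) hn'.le
    gcongr
  have hlim : Tendsto (fun n : ℕ => (⌊a * n⌋₊ : ℝ) / n * (1 - d * Real.exp δ ^ n)) atTop
      (𝓝 a) := by
    have h1 := (tendsto_nat_floor_mul_div_atTop ha0).comp (tendsto_natCast_atTop_atTop (R := ℝ))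
    have h2 := ((tendsto_pow_atTop_nhds_zero_of_lt_one (Real.exp_pos δ).le
      (Real.exp_zero ▸ Real.exp_lt_exp.2 hneg)).const_mul (d : ℝ)).const_sub 1
    simpa using h1.mul h2
  exact le_of_tendsto_of_tendsto hlim (tendsto_expectedLCS_div (by omega) hd)
    ((eventually_gt_atTop 0).mono hbound)

theorem le_chvatalSankoff {k d : ℕ} (hk : 2 ≤ k) (hd : 0 < d) :
    1 / (k : ℝ) * (1 + 1 / 4 / √d) ≤ chvatalSankoff k d := by
  have hk0 : (0 : ℝ) < k := by exact_mod_cast (by omega : 0 < k)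
  refine le_of_forall_lt_imp_le_of_dense fun a ha => ?_
  rcases le_or_gt a 0 with h0 | h0
  · exact h0.trans (le_chvatalSankoff_of_lt hk hd le_rfl (by simp))
  refine le_chvatalSankoff_of_lt hk hd h0.le ?_
  set u := 1 / 4 / √(d : ℝ) with hu
  have hu0 : 0 ≤ u := by positivity
  have hu1 : u ≤ 1 / 4 := by
    have : 1 ≤ √(d : ℝ) := Real.one_le_sqrt.2 (by exact_mod_cast hd)
    exact div_le_self (by norm_num) this
  have h1 : 1 / (2 * √(d : ℝ)) = 2 * u := by
    rw [hu]
    ring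
  rw [h1]
  have h2 : a * k < 1 + u := by
    rw [one_div, inv_mul_eq_div, lt_div_iff₀ hk0] at ha
    exact ha
  -- The mean cost is `k * (1 - u)`, and `(1 + u) * (1 - u) ≤ 1`.
  nlinarith [mul_pos h0 hk0]

end LowerBound

theorem theorem2 :
    ∃ c₀ c₁ c₂ : ℝ, 0 < c₀ ∧ 0 < c₁ ∧ 0 < c₂ ∧
      ∀ k d : ℕ, 2 ≤ k → c₀ * Real.logb 2 (k : ℝ) ≤ (d : ℝ) →
        Tendsto (fun n : ℕ => expectedLCS k d n / (n : ℝ)) atTop (𝓝 (chvatalSankoff k d)) ∧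
        (1 / (k : ℝ)) * (1 + c₁ / Real.sqrt (d : ℝ)) ≤ chvatalSankoff k d ∧
        chvatalSankoff k d ≤
          (1 / (k : ℝ)) * (1 + c₂ * Real.sqrt (Real.logb 2 (k : ℝ) / (d : ℝ))) := by
  -- With `ε = 3 √(logb 2 k / d)`, the choice `c₀ = 9` forces `ε ≤ 1`, and `d ε² / 3 = 3 logb 2 k`
  -- exceeds `2 log k`.
  refine ⟨9, 1 / 4, 3, by norm_num, by norm_num, by norm_num, fun k d hk hkd => ?_⟩
  have hk2 : (2 : ℝ) ≤ k := by exact_mod_cast hk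
  have hlog : 0 < Real.log k := Real.log_pos (by linarith)
  have hle : Real.log k ≤ Real.logb 2 k := by
    unfold Real.logb
    exact le_div_self hlog.le (Real.log_pos one_lt_two) (by linarith [Real.log_two_lt_d9])
  have hd' : (0 : ℝ) < d := by linarith
  have hd : 0 < d := by exact_mod_cast hd'
  refine ⟨tendsto_expectedLCS_div (by omega) hd, le_chvatalSankoff hk hd, ?_⟩
  have hr : 0 < Real.logb 2 k / d := div_pos (by linarith) hd'
  have hsq : √(Real.logb 2 k / d) ^ 2 = Real.logb 2 k / d := Real.sq_sqrt hr.le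
  have hs0 : 0 < √(Real.logb 2 k / d) := Real.sqrt_pos.2 hr
  refine chvatalSankoff_le (by omega) hd (by positivity) ?_ ?_
  · have : Real.logb 2 k / d ≤ 1 / 9 := by
      rw [div_le_iff₀ hd']
      linarith
    nlinarith
  · rw [mul_pow, hsq]
    have : (d : ℝ) * (3 ^ 2 * (Real.logb 2 k / d) / 3) = 3 * Real.logb 2 k := by
      field_simp
    rw [this]
    linarith
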